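/- Let $F$ be a probability distribution on $\mathbb{R}$ (the law of log-returns) with moment generating function $M(s)=\int e^{sx}\,dF(x)$, and define $-q^*=\inf\{s: M(s)<\infty\}$ and $r^*=\sup\{s: M(s)<\infty\}$. For $k\in\mathbb{R}$ and $\sigma>0$ let $$c_{BS}(k,\sigma)=\Phi\left(-\tfrac{k}{\sigma}+\tfrac{\sigma}{2}\right)-e^{k}\,\Phi\left(-\tfrac{k}{\sigma}-\tfrac{\sigma}{2}\right),$$ where $\Phi$ is the standard normal distribution function, and let the implied volatility $V(k)$ be the unique $V(k)>0$ with $$c_{BS}(k,V(k))=\int_{(k,\infty)}(e^{x}-e^{k})\,dF(x).$$ Put $\psi(x)=2-4\left(\sqrt{x^2+x}-x\right)$. Let $R_0$ denote the class of functions slowly varying at infinity: $l$ is positive and measurable on a neighbourhood of $\infty$ and $l(cx)/l(x)\to1$ as $x\to\infty$ for every $c>0$. (i) Suppose $q^*\in(0,\infty)$, $\int e^x\,dF(x)=1$ (risk-neutrality), and that for some $\rho>0$ and $l\in R_0$ at least one of the following holds as $s\to0+$: (I) $(-1)^nM^{(n)}(-q^*+s)\sim s^{-\rho}\,l(1/s)$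 for some integer $n\ge0$; (II) $\log M(-q^*+s)\sim s^{-\rho}\,l(1/s)$. Then $V(-k)$ exists and is unique for all sufficiently large $k$, and $$\lim_{k\to\infty}\frac{V(-k)^2}{k}=\psi(q^*).$$ (ii) Suppose $r^*=p^*+1\in(1,\infty)$ and that for some $\rho>0$ and $l\in R_0$ at least one of the following holds as $s\to0+$: (I) $M^{(n)}(r^*-s)\sim s^{-\rho}\,l(1/s)$ for some integer $n\ge0$; (II) $\log M(r^*-s)\sim s^{-\rho}\,l(1/s)$. Then $V(k)$ exists and is unique for all sufficiently large $k$, and $$\lim_{k\to\infty}\frac{V(k)^2}{k}=\psi(p^*).$$ -/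

import Mathlib

open MeasureTheory ProbabilityTheory Filter Asymptotics
open scoped Topology

namespace Smile

/-- `l ∈ R₀`: `l` is slowly varying at infinity, i.e. positive and measurable on a neighbourhood
of infinity with `l (c x) / l x → 1` as `x → ∞` for every `c > 0`. -/
def SlowlyVarying (l : ℝ → ℝ) : Prop :=
  (∃ X : ℝ, (∀ x, X ≤ x → 0 < l x) ∧ Measurable ((Set.Ici X).domRestrict l)) ∧
    ∀ c : ℝ, 0 < c → Tendsto (fun x => l (c * x) / l x) atTop (𝓝 1)

/-- `f s ∼ s ^ (-ρ) l (1 / s)` as `s → 0+` for some `ρ > 0` and some slowly varying `l`. -/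
def RegularBlowUp (f : ℝ → ℝ) : Prop :=
  ∃ (ρ : ℝ) (l : ℝ → ℝ), 0 < ρ ∧ SlowlyVarying l ∧
    f ~[𝓝[>] 0] fun s => s ^ (-ρ) * l (1 / s)

/-- Criterion I at the left critical exponent `-q`. The sign `(-1) ^ n` is the sign of the
`n`-th derivative of the moment generating function close to `-q` when it blows up there. -/
def CriterionILeft (μ : Measure ℝ) (q : ℝ) : Prop :=
  ∃ n : ℕ, RegularBlowUp fun s => (-1) ^ n * iteratedDeriv n (mgf id μ) (-q + s)

/-- Criterion I at the right critical exponent `r`. -/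
def CriterionIRight (μ : Measure ℝ) (r : ℝ) : Prop :=
  ∃ n : ℕ, RegularBlowUp fun s => iteratedDeriv n (mgf id μ) (r - s)

/-- Criterion II at the left critical exponent `-q`. -/
def CriterionIILeft (μ : Measure ℝ) (q : ℝ) : Prop :=
  RegularBlowUp fun s => Real.log (mgf id μ (-q + s))

/-- Criterion II at the right critical exponent `r`. -/
def CriterionIIRight (μ : Measure ℝ) (r : ℝ) : Prop :=
  RegularBlowUp fun s => Real.log (mgf id μ (r - s))

/-- Normalized Black-Scholes call price with log-strike `k` and (positive) total volatility `σ`. -/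
noncomputable def bsCall (k σ : ℝ) : ℝ :=
  cdf (gaussianReal 0 1) (-k / σ + σ / 2)
    - Real.exp k * cdf (gaussianReal 0 1) (-k / σ - σ / 2)

/-- Normalized call price with log-strike `k` when log-returns have law `μ`. -/
noncomputable def callPrice (μ : Measure ℝ) (k : ℝ) : ℝ :=
  ∫ x in Set.Ioi k, (Real.exp x - Real.exp k) ∂μ

/-- `v` is a Black-Scholes implied volatility at log-strike `k`. -/
def IsImpliedVol (μ : Measure ℝ) (k v : ℝ) : Prop :=
  0 < v ∧ bsCall k v = callPrice μ k

/-- The implied volatility `V k`, meaningful when exactly one `v` satisfies `IsImpliedVol μ k v`. -/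
noncomputable def impliedVol (μ : Measure ℝ) (k : ℝ) : ℝ :=
  Classical.epsilon (IsImpliedVol μ k)

/-- The function `ψ`. -/
noncomputable def psi (x : ℝ) : ℝ := 2 - 4 * (√(x ^ 2 + x) - x)

end Smile

/-!
Both wings reduce to one statement about tails. Let `r > 0` be the right critical exponent of a law
`μ`. The claim is that `μ (x, ∞) ≥ exp (-(r + ε) x)` for all large `x`, for every `ε > 0`; the
matching upper bound is Chernoff's inequality. The left wing is the right wing of the law of the
negative log-return, by put-call parity and put-call symmetry.

*Regular variation.* Only the convergence of the ratios `f (c s) / f s` to `c ^ (-ρ)` as `s → 0+` is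
used (`RegularlyVarying`), so the measurability of the slowly varying function plays no role. It
makes the moment blow up along a sequence, and then everywhere since the contribution of the positive
half-line is monotone and that of the negative half-line is bounded (`tendsto_moment_atTop`).

*Criterion I.* The Laplace transforms of the weights `y ^ n * exp (r * y)` against `μ`, rescaled by
`1 / s`, converge to that of a Gamma density. By Karamata's polynomial approximation
(`tendsto_integral_comp_exp_neg_mul`) the integrals of a bump in `exp (-s y)` converge to a positive
number. Hence a mass bounded below sits in `1 / s < y < β / s`, for any `β > 1`, which forces
`μ (1 / s, ∞) ≥ (s / β) ^ n * exp (-r β / s)` for small `s` (`eventually_exp_le_of_moment`).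

*Criterion II.* Let `M` be the moment generating function. Under the law tilted by `exp ((r - s) y)`,
Chernoff bounds on both sides show concentration around `m = ρ * log M(r - s) / s`, up to a factor
`β` arbitrarily close to `1`: the exponents are `log M(r - s)` times
`(1 - t) ^ (-ρ) - 1 - t * ρ * θ`, whose derivative at `t = 0` is `ρ * (1 - θ)`, so a small `t` of the
right sign makes it negative for `θ = β` and for `θ = β⁻¹` (`eventually_setIntegral_exp_le`). Undoing
the tilt gives the tail bound at `m / β`, and as `s → 0+` this threshold runs continuously to infinity
(`eventually_exp_le_of_log_mgf`).

*Implied volatility.* The tail bounds show that the call price (the put price, on the left) decays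
like `exp (-p k)` up to `exp (o(k))`. The Black-Scholes price is strictly increasing in the total
volatility and at total volatility `a √k` with `a < √2` decays at rate `(1 / a - a / 2) ^ 2 / 2`. So
the implied volatility is asymptotic to `a √k`, where `a` is the positive solution of
`1 / a - a / 2 = √(2 p)`, and `a ^ 2 = ψ(p)` (`tendsto_sq_div_of_bsCall_eq`).
-/

namespace Smile

/-! ### The standard normal distribution function -/

lemma hasDerivAt_cdf_gaussianReal (x : ℝ) :
    HasDerivAt (cdf (gaussianReal 0 1)) (gaussianPDFReal 0 1 x) x := by
  have hint : Integrable (gaussianPDFReal 0 1) := integrable_gaussianPDFReal 0 1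
  have hcont : Continuous (gaussianPDFReal 0 1) := by
    rw [gaussianPDFReal_def]; fun_prop
  have hcdf : ∀ y, cdf (gaussianReal 0 1) y = ∫ t in Set.Iic y, gaussianPDFReal 0 1 t := by
    intro y
    rw [cdf_eq_real, measureReal_def, gaussianReal_apply_eq_integral _ one_ne_zero,
      ENNReal.toReal_ofReal (integral_nonneg fun t => gaussianPDFReal_nonneg 0 1 t)]
  have hsplit : ∀ y, cdf (gaussianReal 0 1) y
      = (∫ t in (0 : ℝ)..y, gaussianPDFReal 0 1 t) + cdf (gaussianReal 0 1) 0 := by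
    intro y
    rw [hcdf, hcdf, ← intervalIntegral.integral_Iic_sub_Iic hint.integrableOn hint.integrableOn]
    ring
  have h := (intervalIntegral.integral_hasDerivAt_right (hcont.intervalIntegrable 0 x)
    (hcont.stronglyMeasurableAtFilter _ _) hcont.continuousAt).add_const
      (cdf (gaussianReal 0 1) 0)
  exact h.congr_of_eventuallyEq (Eventually.of_forall hsplit)

lemma cdf_gaussianReal_neg_le {x : ℝ} (hx : 0 ≤ x) :
    cdf (gaussianReal 0 1) (-x) ≤ Real.exp (-(x ^ 2 / 2)) := by
  have h := measure_le_le_exp_cgf (μ := gaussianReal 0 1) (X := id) (t := -x) (-x) (by linarith)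
    (by simpa using integrable_exp_mul_gaussianReal (μ := 0) (v := 1) (-x))
  rw [cgf_gaussianReal (μ := 0) (v := 1) (by simp)] at h
  rw [cdf_eq_real]
  refine (le_of_eq ?_).trans (h.trans (le_of_eq ?_))
  · rfl
  · congr 1
    push_cast
    ring

lemma cdf_gaussianReal_neg (x : ℝ) :
    cdf (gaussianReal 0 1) (-x) = 1 - cdf (gaussianReal 0 1) x := by
  have hmap : (gaussianReal 0 1).map (fun y => -y) = gaussianReal 0 1 := by
    simpa using gaussianReal_map_neg (μ := 0) (v := 1)
  have hna : NullSingletonClass (gaussianReal 0 1) := nullSingletonClass_gaussianReal one_ne_zero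
  rw [cdf_eq_real, cdf_eq_real, ← probReal_compl_eq_one_sub measurableSet_Iic]
  nth_rewrite 1 [← hmap]
  rw [map_measureReal_apply measurable_neg measurableSet_Iic, Set.compl_Iic]
  have : (fun y : ℝ => -y) ⁻¹' Set.Iic (-x) = Set.Ici x := by
    ext y; simp
  rw [this]
  exact measureReal_congr Ioi_ae_eq_Ici.symm

/-! ### Monotonicity and inversion of the Black-Scholes price -/

/-- The vega of a call: the terms from the two occurrences of the distribution function combine
because `exp k` times the density at `-k / σ - σ / 2` is the density at `-k / σ + σ / 2`. -/
lemma hasDerivAt_bsCall (k : ℝ) {σ : ℝ} (hσ : 0 < σ) :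
    HasDerivAt (bsCall k) (gaussianPDFReal 0 1 (-k / σ + σ / 2)) σ := by
  have hne := hσ.ne'
  have h0 : HasDerivAt (fun s : ℝ => -k / s) (k / σ ^ 2) σ := by
    refine ((hasDerivAt_inv hne).const_mul (-k)).congr_deriv ?_
    field_simp
  have h1 : HasDerivAt (fun s : ℝ => -k / s + s / 2) (k / σ ^ 2 + 1 / 2) σ :=
    h0.add ((hasDerivAt_id σ).div_const 2)
  have h2 : HasDerivAt (fun s : ℝ => -k / s - s / 2) (k / σ ^ 2 - 1 / 2) σ :=
    h0.sub ((hasDerivAt_id σ).div_const 2)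
  have key : Real.exp k * gaussianPDFReal 0 1 (-k / σ - σ / 2)
      = gaussianPDFReal 0 1 (-k / σ + σ / 2) := by
    simp only [gaussianPDFReal]
    rw [mul_left_comm, ← Real.exp_add]
    congr 2
    push_cast
    field_simp
    ring
  have h := ((hasDerivAt_cdf_gaussianReal _).comp σ h1).sub
    (((hasDerivAt_cdf_gaussianReal _).comp σ h2).const_mul (Real.exp k))
  refine h.congr_deriv ?_
  rw [← mul_assoc, key]
  ring

lemma strictMonoOn_bsCall (k : ℝ) : StrictMonoOn (bsCall k) (Set.Ioi 0) := by
  refine strictMonoOn_of_deriv_pos (convex_Ioi 0)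
    (fun σ hσ => (hasDerivAt_bsCall k hσ).continuousAt.continuousWithinAt) fun σ hσ => ?_
  rw [interior_Ioi] at hσ
  rw [(hasDerivAt_bsCall k hσ).deriv]
  exact gaussianPDFReal_pos 0 1 _ one_ne_zero

lemma tendsto_bsCall_zero {k : ℝ} (hk : 0 < k) : Tendsto (bsCall k) (𝓝[>] 0) (𝓝 0) := by
  have h0 : Tendsto (fun s : ℝ => -k / s) (𝓝[>] 0) atBot := by
    simpa only [div_eq_mul_inv] using
      tendsto_inv_nhdsGT_zero.const_mul_atTop_of_neg (neg_lt_zero.2 hk)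
  have hs : Tendsto (fun s : ℝ => s / 2) (𝓝[>] 0) (𝓝 0) := by
    have : Tendsto (fun s : ℝ => s / 2) (𝓝 0) (𝓝 (0 / 2)) := (continuous_id.div_const 2).tendsto 0
    simpa using this.mono_left nhdsWithin_le_nhds
  have h1 := (tendsto_cdf_atBot (gaussianReal 0 1)).comp (h0.atBot_add hs)
  have h2 := (tendsto_cdf_atBot (gaussianReal 0 1)).comp (h0.atBot_add hs.neg)
  have h := h1.sub (h2.const_mul (Real.exp k))
  simp only [mul_zero, sub_zero] at h
  exact h

lemma tendsto_bsCall_atTop (k : ℝ) : Tendsto (bsCall k) atTop (𝓝 1) := by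
  have h0 : Tendsto (fun s : ℝ => -k / s) atTop (𝓝 0) := tendsto_const_nhds.div_atTop tendsto_id
  have hs : Tendsto (fun s : ℝ => s / 2) atTop atTop := tendsto_id.atTop_div_const two_pos
  have h1 := (tendsto_cdf_atTop (gaussianReal 0 1)).comp (h0.add_atTop hs)
  have h2 := (tendsto_cdf_atBot (gaussianReal 0 1)).comp
    (h0.add_atBot (tendsto_neg_atTop_atBot.comp hs))
  have h := h1.sub (h2.const_mul (Real.exp k))
  simp only [mul_zero, sub_zero] at h
  exact h

lemma bsCall_nonneg {k σ : ℝ} (hk : 0 < k) (hσ : 0 < σ) : 0 ≤ bsCall k σ := by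
  refine le_of_tendsto (tendsto_bsCall_zero hk) ?_
  filter_upwards [Ioo_mem_nhdsGT hσ] with s hs
  exact (strictMonoOn_bsCall k hs.1 hσ hs.2).le

lemma existsUnique_bsCall_eq {k c : ℝ} (hk : 0 < k) (hc : c ∈ Set.Ioo (0 : ℝ) 1) :
    ∃! v, 0 < v ∧ bsCall k v = c := by
  have hcont : ContinuousOn (bsCall k) (Set.Ioi 0) :=
    fun σ hσ => (hasDerivAt_bsCall k hσ).continuousAt.continuousWithinAt
  obtain ⟨v, hv, rfl⟩ := isPreconnected_Ioi.intermediate_value_Ioo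
    (l₁ := 𝓝[>] 0) (l₂ := atTop) inf_le_right (le_principal_iff.2 (Ioi_mem_atTop 0)) hcont
    (tendsto_bsCall_zero hk) (tendsto_bsCall_atTop k) hc
  exact ⟨v, ⟨hv, rfl⟩, fun w hw => (strictMonoOn_bsCall k).injOn hw.1 hv hw.2⟩

/-- Put-call parity together with the put-call symmetry of the Black-Scholes price. -/
lemma bsCall_neg (k σ : ℝ) :
    bsCall (-k) σ = 1 - Real.exp (-k) + Real.exp (-k) * bsCall k σ := by
  have h1 : -(-k) / σ + σ / 2 = -(-k / σ - σ / 2) := by ring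
  have h2 : -(-k) / σ - σ / 2 = -(-k / σ + σ / 2) := by ring
  have h3 : Real.exp (-k) * Real.exp k = 1 := by rw [← Real.exp_add]; simp
  simp only [bsCall]
  rw [h1, h2, cdf_gaussianReal_neg, cdf_gaussianReal_neg]
  linear_combination (cdf (gaussianReal 0 1) (-k / σ - σ / 2)) * h3

/-! ### Asymptotics of the implied volatility from the exponential rate of prices -/

lemma psi_eq_sq {p : ℝ} (hp : 0 < p) : psi p = (√(2 * p + 2) - √(2 * p)) ^ 2 := by
  have h : √(p ^ 2 + p) = √(2 * p + 2) * √(2 * p) / 2 := by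
    rw [← Real.sqrt_mul (by linarith), Real.sqrt_eq_iff_mul_self_eq (by positivity) (by positivity)]
    have := Real.mul_self_sqrt (show 0 ≤ (2 * p + 2) * (2 * p) by positivity)
    linarith
  have h1 := Real.sq_sqrt (show 0 ≤ 2 * p + 2 by linarith)
  have h2 := Real.sq_sqrt (show 0 ≤ 2 * p by linarith)
  rw [psi, h, sub_sq, h1, h2]
  ring

lemma neg_div_add_half_mul_sqrt {k a : ℝ} (hk : 0 < k) (ha : 0 < a) :
    -k / (a * √k) + a * √k / 2 = -(√k * (1 / a - a / 2)) := by
  have hs : 0 < √k := Real.sqrt_pos.2 hk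
  have := Real.sq_sqrt hk.le
  field_simp
  rw [this]
  ring

lemma bsCall_mul_sqrt_le {k a : ℝ} (hk : 0 < k) (ha : 0 < a) (hu : 0 ≤ 1 / a - a / 2) :
    bsCall k (a * √k) ≤ Real.exp (-((1 / a - a / 2) ^ 2 / 2) * k) := by
  have h1 : bsCall k (a * √k) ≤ cdf (gaussianReal 0 1) (-(√k * (1 / a - a / 2))) := by
    rw [← neg_div_add_half_mul_sqrt hk ha, bsCall]
    have := mul_nonneg (Real.exp_pos k).le
      (cdf_nonneg (gaussianReal 0 1) (-k / (a * √k) - a * √k / 2))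
    linarith
  refine h1.trans ((cdf_gaussianReal_neg_le (by positivity)).trans (le_of_eq ?_))
  rw [mul_pow, Real.sq_sqrt hk.le]
  congr 1
  ring

/-- The mean value theorem between total volatilities `b √k` and `a √k`: below total variance `2 k`
the vega increases, hence is at least its value at `b √k`. -/
lemma le_bsCall_mul_sqrt {k a b : ℝ} (hk : 0 < k) (hb : 0 < b) (hba : b < a)
    (hu : 0 ≤ 1 / a - a / 2) :
    (a - b) * √k * ((√(2 * Real.pi))⁻¹ * Real.exp (-((1 / b - b / 2) ^ 2 / 2) * k))
      ≤ bsCall k (a * √k) := by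
  have hs : 0 < √k := Real.sqrt_pos.2 hk
  have hlt : b * √k < a * √k := by gcongr
  obtain ⟨t, ht, hte⟩ := exists_hasDerivAt_eq_slope (bsCall k)
    (fun s => gaussianPDFReal 0 1 (-k / s + s / 2)) hlt
    (fun s hs' => (hasDerivAt_bsCall k (lt_of_lt_of_le (by positivity) hs'.1)).continuousAt
      |>.continuousWithinAt)
    (fun s hs' => hasDerivAt_bsCall k (lt_trans (by positivity) hs'.1))
  have hnn := bsCall_nonneg hk (show 0 < b * √k by positivity)
  rw [eq_div_iff (by linarith)] at hte
  obtain ⟨d, rfl⟩ : ∃ d, t = d * √k := ⟨t / √k, by field_simp⟩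
  have hbd : b < d := lt_of_mul_lt_mul_right ht.1 hs.le
  have hda : d < a := lt_of_mul_lt_mul_right ht.2 hs.le
  have hd : 0 < d := hb.trans hbd
  have hud : 0 ≤ 1 / d - d / 2 := by
    have : 1 / a ≤ 1 / d := by gcongr
    linarith
  have hub : 1 / d - d / 2 ≤ 1 / b - b / 2 := by
    have : 1 / d ≤ 1 / b := by gcongr
    linarith
  have hpdf : (√(2 * Real.pi))⁻¹ * Real.exp (-((1 / b - b / 2) ^ 2 / 2) * k)
      ≤ gaussianPDFReal 0 1 (-k / (d * √k) + d * √k / 2) := by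
    rw [neg_div_add_half_mul_sqrt hk hd, gaussianPDFReal]
    simp only [NNReal.coe_one, mul_one, sub_zero, neg_sq, mul_pow, Real.sq_sqrt hk.le]
    have : (1 / d - d / 2) ^ 2 * k ≤ (1 / b - b / 2) ^ 2 * k := by gcongr
    gcongr
    linarith
  calc _ ≤ (a - b) * √k * gaussianPDFReal 0 1 (-k / (d * √k) + d * √k / 2) := by
        have : 0 ≤ (a - b) * √k := mul_nonneg (by linarith) hs.le
        gcongr
    _ ≤ _ := by linarith

/-- If `c k` decays exponentially at rate `p`, then any inverse Black-Scholes total volatility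
`V k` of the price `c k` is asymptotic to `√(ψ(p) k)`. -/
lemma tendsto_sq_div_of_bsCall_eq {c V : ℝ → ℝ} {p : ℝ} (hp : 0 < p)
    (hlow : ∀ ε > 0, ∀ᶠ k in atTop, Real.exp (-(p + ε) * k) ≤ c k)
    (hup : ∀ ε > 0, ∀ᶠ k in atTop, c k ≤ Real.exp (-(p - ε) * k))
    (hV : ∀ᶠ k in atTop, 0 < V k ∧ bsCall k (V k) = c k) :
    Tendsto (fun k => V k ^ 2 / k) atTop (𝓝 (psi p)) := by
  set w := √(2 * p) with hw
  have hw0 : 0 < w := Real.sqrt_pos.2 (by linarith)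
  have hw2 : w ^ 2 = 2 * p := Real.sq_sqrt (by linarith)
  set z := √(2 * p + 2) - w with hz
  have hsq : √(2 * p + 2) ^ 2 = 2 * p + 2 := Real.sq_sqrt (by linarith)
  have hz0 : 0 < z := sub_pos.2 (Real.sqrt_lt_sqrt (by linarith) (by linarith))
  -- `z` is the positive root of `1 / z - z / 2 = √(2 p)`
  have huz : 1 / z - z / 2 = w := by
    have : (z + w) ^ 2 = w ^ 2 + 2 := by rw [hz]; linear_combination hsq - hw2
    field_simp
    linarith
  have hanti : ∀ {a b : ℝ}, 0 < a → a < b → 1 / b - b / 2 < 1 / a - a / 2 := by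
    intro a b ha hab
    have := one_div_lt_one_div_of_lt ha hab
    linarith
  have hlim : Tendsto (fun k => V k / √k) atTop (𝓝 z) := by
    refine tendsto_order.2 ⟨fun a ha => ?_, fun a ha => ?_⟩
    · rcases le_or_gt a 0 with ha0 | ha0
      · filter_upwards [hV, eventually_gt_atTop 0] with k hk hk0
        exact ha0.trans_lt (div_pos hk.1 (Real.sqrt_pos.2 hk0))
      · have hua := hanti ha0 ha
        rw [huz] at hua
        have hgt : p < (1 / a - a / 2) ^ 2 / 2 := by nlinarith
        filter_upwards [hV, eventually_gt_atTop 0,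
          hlow (((1 / a - a / 2) ^ 2 / 2 - p) / 2) (by linarith)] with k hk hk0 hc
        have hs : 0 < √k := Real.sqrt_pos.2 hk0
        rw [lt_div_iff₀ hs]
        rw [← (strictMonoOn_bsCall k).lt_iff_lt (show a * √k ∈ Set.Ioi 0 from mul_pos ha0 hs) hk.1,
          hk.2]
        refine (bsCall_mul_sqrt_le hk0 ha0 (by linarith)).trans_lt (lt_of_lt_of_le ?_ hc)
        rw [Real.exp_lt_exp]
        exact mul_lt_mul_of_pos_right (by linarith) hk0
    · have h2 : (√2 : ℝ) ^ 2 = 2 := Real.sq_sqrt (by norm_num)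
      have h20 : (0 : ℝ) < √2 := by positivity
      have hu2 : 1 / √2 - √2 / 2 = 0 := by field_simp; linarith
      have hz2 : z < √2 := by
        by_contra hcon
        rcases (not_lt.1 hcon).eq_or_lt with h | h
        · rw [← h, hu2] at huz; linarith
        · have := hanti h20 h; linarith
      -- total variance `2 k` is where the vega stops increasing
      set a' := min a √2 with ha'
      have hza' : z < a' := lt_min ha hz2
      have hua' : 0 ≤ 1 / a' - a' / 2 := by
        rcases (min_le_right a √2).eq_or_lt with h | h
        · rw [ha', h, hu2]
        · have := hanti (hz0.trans hza') h; linarith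
      obtain ⟨b, hzb, hba⟩ := exists_between hza'
      have hb0 := hz0.trans hzb
      have hub := hanti hz0 hzb
      have hub' := hanti hb0 hba
      rw [huz] at hub
      have hlt : (1 / b - b / 2) ^ 2 / 2 < p := by nlinarith
      have hgrow : Tendsto (fun k => (a' - b) * √k * (√(2 * Real.pi))⁻¹) atTop atTop :=
        (Real.tendsto_sqrt_atTop.const_mul_atTop (sub_pos.2 hba)).atTop_mul_const (by positivity)
      filter_upwards [hV, eventually_gt_atTop 0, hgrow.eventually_ge_atTop 1,
        hup ((p - (1 / b - b / 2) ^ 2 / 2) / 2) (by linarith)] with k hk hk0 hg hc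
      have hs : 0 < √k := Real.sqrt_pos.2 hk0
      rw [div_lt_iff₀ hs]
      refine lt_of_lt_of_le ?_ (mul_le_mul_of_nonneg_right (min_le_left a √2) hs.le)
      rw [← (strictMonoOn_bsCall k).lt_iff_lt hk.1
        (show a' * √k ∈ Set.Ioi 0 from mul_pos (hb0.trans hba) hs), hk.2]
      refine hc.trans_lt (lt_of_lt_of_le ?_ (le_bsCall_mul_sqrt hk0 hb0 hba hua'))
      rw [← mul_assoc]
      refine lt_of_lt_of_le ?_ (le_mul_of_one_le_left (Real.exp_pos _).le hg)
      rw [Real.exp_lt_exp]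
      exact mul_lt_mul_of_pos_right (by linarith) hk0
  rw [psi_eq_sq hp]
  refine (hlim.pow 2).congr' ?_
  filter_upwards [eventually_gt_atTop 0] with k hk
  rw [div_pow, Real.sq_sqrt hk.le]

/-! ### Regular variation at zero -/

/-- `f` is eventually positive and regularly varying with index `-ρ` at `0+`. Measurability is not
part of the definition: the pointwise limits of ratios are all that is used. -/
def RegularlyVarying (f : ℝ → ℝ) (ρ : ℝ) : Prop :=
  (∀ᶠ s in 𝓝[>] 0, 0 < f s) ∧
    ∀ c : ℝ, 0 < c → Tendsto (fun s => f (c * s) / f s) (𝓝[>] 0) (𝓝 (c ^ (-ρ)))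

lemma tendsto_const_mul_nhdsGT_zero {c : ℝ} (hc : 0 < c) :
    Tendsto (fun s : ℝ => c * s) (𝓝[>] 0) (𝓝[>] 0) := by
  refine tendsto_nhdsWithin_iff.2 ⟨?_, ?_⟩
  · have : Tendsto (fun s : ℝ => c * s) (𝓝 0) (𝓝 (c * 0)) := (continuous_const_mul c).tendsto 0
    simpa using this.mono_left nhdsWithin_le_nhds
  · filter_upwards [self_mem_nhdsWithin] with s hs
    exact mul_pos hc hs

lemma RegularlyVarying.of_isEquivalent {f g : ℝ → ℝ} {ρ : ℝ} (hg : RegularlyVarying g ρ)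
    (hfg : f ~[𝓝[>] 0] g) : RegularlyVarying f ρ := by
  have hne : ∀ᶠ s in 𝓝[>] 0, g s ≠ 0 := hg.1.mono fun s hs => hs.ne'
  have h1 : Tendsto (f / g) (𝓝[>] 0) (𝓝 1) := (isEquivalent_iff_tendsto_one hne).1 hfg
  have hpos : ∀ᶠ s in 𝓝[>] 0, 0 < f s := by
    filter_upwards [hg.1, h1.eventually (lt_mem_nhds one_pos)] with s hs hs'
    exact (div_pos_iff_of_pos_right hs).1 hs'
  refine ⟨hpos, fun c hc => ?_⟩
  have hm := tendsto_const_mul_nhdsGT_zero hc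
  have h2 := ((h1.comp hm).mul (hg.2 c hc)).div h1 one_ne_zero
  rw [one_mul, div_one] at h2
  refine h2.congr' ?_
  filter_upwards [hg.1, hm.eventually hg.1, hpos] with s h3 h4 h5
  simp only [Pi.div_apply, Function.comp_apply]
  field_simp

lemma RegularBlowUp.exists_regularlyVarying {f : ℝ → ℝ} (hf : RegularBlowUp f) :
    ∃ ρ, 0 < ρ ∧ RegularlyVarying f ρ := by
  obtain ⟨ρ, l, hρ, ⟨⟨X, hX, -⟩, hl⟩, hfl⟩ := hf
  have hinv : Tendsto (fun s : ℝ => 1 / s) (𝓝[>] 0) atTop := by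
    simpa only [one_div] using tendsto_inv_nhdsGT_zero
  have hlpos : ∀ᶠ s in 𝓝[>] (0 : ℝ), 0 < l (1 / s) :=
    (hinv.eventually_ge_atTop X).mono fun s hs => hX _ hs
  refine ⟨ρ, hρ, RegularlyVarying.of_isEquivalent ⟨?_, fun c hc => ?_⟩ hfl⟩
  · filter_upwards [hlpos, self_mem_nhdsWithin] with s hs hs0
    exact mul_pos (Real.rpow_pos_of_pos hs0 _) hs
  · have h := ((hl c⁻¹ (inv_pos.2 hc)).comp hinv).const_mul (c ^ (-ρ))
    rw [mul_one] at h
    refine h.congr' ?_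
    filter_upwards [hlpos, self_mem_nhdsWithin] with s hs hs0
    have hs0' : (0 : ℝ) < s := hs0
    have e : 1 / (c * s) = c⁻¹ * (1 / s) := by field_simp
    have := Real.rpow_pos_of_pos hs0' (-ρ)
    simp only [Function.comp_apply]
    rw [Real.mul_rpow hc.le hs0'.le, e]
    field_simp

/-- Halving `s` multiplies `f s` by a factor bounded below by a constant larger than `1`, so `f` is
unbounded along the sequence `s₀ / 2 ^ j`. -/
lemma RegularlyVarying.exists_seq_tendsto_atTop {f : ℝ → ℝ} {ρ : ℝ} (hρ : 0 < ρ)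
    (hf : RegularlyVarying f ρ) :
    ∃ u : ℕ → ℝ, Tendsto u atTop (𝓝[>] 0) ∧ Tendsto (fun j => f (u j)) atTop atTop := by
  have h1 : (1 : ℝ) < (1 / 2 : ℝ) ^ (-ρ) :=
    Real.one_lt_rpow_of_pos_of_lt_one_of_neg (by norm_num) (by norm_num) (by linarith)
  obtain ⟨q, hq1, hq⟩ := exists_between h1
  have hev := (hf.2 (1 / 2) (by norm_num)).eventually (lt_mem_nhds hq)
  obtain ⟨s₀, hs₀, hs⟩ := mem_nhdsGT_iff_exists_Ioc_subset.1 (inter_mem hev hf.1)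
  have hs₀' : (0 : ℝ) < s₀ := hs₀
  have hmem : ∀ j : ℕ, (1 / 2 : ℝ) ^ j * s₀ ∈ Set.Ioc 0 s₀ := fun j =>
    ⟨by positivity, mul_le_of_le_one_left hs₀'.le (pow_le_one₀ (by norm_num) (by norm_num))⟩
  have hpow : ∀ j : ℕ, q ^ j * f s₀ ≤ f ((1 / 2 : ℝ) ^ j * s₀) := by
    intro j
    induction j with
    | zero => simp
    | succ j ih =>
      have h2 := hs (hmem j)
      have h3 : q < f (1 / 2 * ((1 / 2 : ℝ) ^ j * s₀)) / f ((1 / 2 : ℝ) ^ j * s₀) := h2.1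
      have h4 : 0 < f ((1 / 2 : ℝ) ^ j * s₀) := h2.2
      rw [lt_div_iff₀ h4] at h3
      have e : (1 / 2 : ℝ) ^ (j + 1) * s₀ = 1 / 2 * ((1 / 2 : ℝ) ^ j * s₀) := by ring
      rw [e, pow_succ, mul_comm (q ^ j) q, mul_assoc]
      exact (mul_le_mul_of_nonneg_left ih (by linarith)).trans h3.le
  have hf0 : 0 < f s₀ := (hs ⟨hs₀', le_rfl⟩).2
  refine ⟨fun j => (1 / 2 : ℝ) ^ j * s₀, tendsto_nhdsWithin_iff.2 ⟨?_, ?_⟩,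
    tendsto_atTop_mono hpow ((tendsto_pow_atTop_atTop_of_one_lt hq1).atTop_mul_const hf0)⟩
  · simpa using (tendsto_pow_atTop_nhds_zero_of_lt_one (r := (1 / 2 : ℝ)) (by norm_num)
      (by norm_num)).mul_const s₀
  · exact Eventually.of_forall fun j => (hmem j).1

/-! ### Continuity of the Laplace transform -/

section Laplace

variable {μ γ : Measure ℝ} {w v f : ℝ → ℝ} {s : ℝ}

lemma integrable_comp_exp_neg_mul (hw0 : ∀ y ≤ 0, w y = 0) (hw : ∀ y, 0 ≤ w y) (hs : 0 < s)
    (hint : Integrable (fun y => w y * Real.exp (-(s * y))) μ) (hf : Continuous f) :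
    Integrable (fun y => f (Real.exp (-(s * y))) * (w y * Real.exp (-(s * y)))) μ := by
  obtain ⟨C, hC⟩ := isCompact_Icc.exists_bound_of_continuousOn (s := Set.Icc (0 : ℝ) 1)
    hf.continuousOn
  refine (hint.const_mul C).mono' ((by fun_prop : Continuous fun y : ℝ =>
    f (Real.exp (-(s * y)))).aestronglyMeasurable.mul hint.aestronglyMeasurable)
    (Eventually.of_forall fun y => ?_)
  rcases le_or_gt y 0 with hy | hy
  · simp [hw0 y hy]
  · have hnn : 0 ≤ w y * Real.exp (-(s * y)) := mul_nonneg (hw y) (Real.exp_pos _).le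
    rw [norm_mul, Real.norm_of_nonneg hnn]
    refine mul_le_mul_of_nonneg_right (hC _ ⟨(Real.exp_pos _).le, ?_⟩) hnn
    rw [Real.exp_le_one_iff]
    nlinarith

lemma abs_integral_comp_exp_neg_mul_le (hw0 : ∀ y ≤ 0, w y = 0) (hw : ∀ y, 0 ≤ w y) (hs : 0 < s)
    (hint : Integrable (fun y => w y * Real.exp (-(s * y))) μ) {C : ℝ}
    (hC : ∀ x ∈ Set.Icc (0 : ℝ) 1, |f x| ≤ C) :
    |∫ y, f (Real.exp (-(s * y))) * (w y * Real.exp (-(s * y))) ∂μ|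
      ≤ C * ∫ y, w y * Real.exp (-(s * y)) ∂μ := by
  rw [← integral_const_mul, ← Real.norm_eq_abs]
  refine norm_integral_le_of_norm_le (hint.const_mul C) (Eventually.of_forall fun y => ?_)
  rcases le_or_gt y 0 with hy | hy
  · simp [hw0 y hy]
  · have hnn : 0 ≤ w y * Real.exp (-(s * y)) := mul_nonneg (hw y) (Real.exp_pos _).le
    rw [norm_mul, Real.norm_of_nonneg hnn]
    refine mul_le_mul_of_nonneg_right (hC _ ⟨(Real.exp_pos _).le, ?_⟩) hnn
    rw [Real.exp_le_one_iff]
    nlinarith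

/-- Karamata's argument: if the normalized Laplace transforms converge at all positive integers, then
the normalized integrals of every continuous function of `exp (-s y)` converge. For polynomials
this is the hypothesis, and the general case follows by Weierstrass approximation on `[0, 1]`. -/
lemma tendsto_integral_comp_exp_neg_mul
    (hw0 : ∀ y ≤ 0, w y = 0) (hw : ∀ y, 0 ≤ w y) (hv0 : ∀ y ≤ 0, v y = 0) (hv : ∀ y, 0 ≤ v y)
    (hwint : ∀ᶠ s in 𝓝[>] 0, Integrable (fun y => w y * Real.exp (-(s * y))) μ)
    (hwpos : ∀ᶠ s in 𝓝[>] 0, 0 < ∫ y, w y * Real.exp (-(s * y)) ∂μ)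
    (hvint : Integrable (fun u => v u * Real.exp (-(1 * u))) γ)
    (hvone : ∫ u, v u * Real.exp (-(1 * u)) ∂γ = 1)
    (hlim : ∀ m : ℕ, Tendsto (fun s => (∫ y, w y * Real.exp (-((m + 1) * s * y)) ∂μ)
      / ∫ y, w y * Real.exp (-(s * y)) ∂μ) (𝓝[>] 0) (𝓝 (∫ u, v u * Real.exp (-((m + 1) * u)) ∂γ)))
    (hf : Continuous f) :
    Tendsto (fun s => (∫ y, f (Real.exp (-(s * y))) * (w y * Real.exp (-(s * y))) ∂μ)
      / ∫ y, w y * Real.exp (-(s * y)) ∂μ) (𝓝[>] 0)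
      (𝓝 (∫ u, f (Real.exp (-(1 * u))) * (v u * Real.exp (-(1 * u))) ∂γ)) := by
  have hs0 : ∀ᶠ s in 𝓝[>] (0 : ℝ), 0 < s := self_mem_nhdsWithin
  have hpoly : ∀ p : Polynomial ℝ,
      Tendsto (fun s => (∫ y, p.eval (Real.exp (-(s * y))) * (w y * Real.exp (-(s * y))) ∂μ)
        / ∫ y, w y * Real.exp (-(s * y)) ∂μ) (𝓝[>] 0)
        (𝓝 (∫ u, p.eval (Real.exp (-(1 * u))) * (v u * Real.exp (-(1 * u))) ∂γ)) := by
    intro p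
    induction p using Polynomial.induction_on' with
    | add p q hp hq =>
      simp only [Polynomial.eval_add, add_mul]
      rw [integral_add (integrable_comp_exp_neg_mul hv0 hv one_pos hvint p.continuous)
        (integrable_comp_exp_neg_mul hv0 hv one_pos hvint q.continuous)]
      refine (hp.add hq).congr' ?_
      filter_upwards [hwint, hs0] with s hint hs
      rw [integral_add (integrable_comp_exp_neg_mul hw0 hw hs hint p.continuous)
        (integrable_comp_exp_neg_mul hw0 hw hs hint q.continuous), add_div]
    | monomial m c =>
      have e : ∀ (x : ℝ → ℝ) (s y : ℝ), (Polynomial.monomial m c).eval (Real.exp (-(s * y)))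
          * (x y * Real.exp (-(s * y))) = c * (x y * Real.exp (-((m + 1) * s * y))) := by
        intro x s y
        rw [Polynomial.eval_monomial, ← Real.exp_nat_mul]
        have : Real.exp (-((m + 1) * s * y)) = Real.exp (m * -(s * y)) * Real.exp (-(s * y)) := by
          rw [← Real.exp_add]
          congr 1
          ring
        rw [this]
        ring
      simp only [e, integral_const_mul, mul_div_assoc, mul_one]
      exact (hlim m).const_mul c
  refine Metric.tendsto_nhds.2 fun ε hε => ?_
  obtain ⟨p, hp⟩ := exists_polynomial_near_of_continuousOn 0 1 f hf.continuousOn (ε / 4)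
    (by linarith)
  have happrox : ∀ (ν : Measure ℝ) (x : ℝ → ℝ) (s : ℝ), (∀ y ≤ 0, x y = 0) → (∀ y, 0 ≤ x y) →
      0 < s → Integrable (fun y => x y * Real.exp (-(s * y))) ν →
      |(∫ y, f (Real.exp (-(s * y))) * (x y * Real.exp (-(s * y))) ∂ν)
        - ∫ y, p.eval (Real.exp (-(s * y))) * (x y * Real.exp (-(s * y))) ∂ν|
        ≤ ε / 4 * ∫ y, x y * Real.exp (-(s * y)) ∂ν := by
    intro ν x s hx0 hx hs hint
    rw [← integral_sub (integrable_comp_exp_neg_mul hx0 hx hs hint hf)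
      (integrable_comp_exp_neg_mul hx0 hx hs hint p.continuous)]
    simp only [← sub_mul]
    refine abs_integral_comp_exp_neg_mul_le (f := fun z => f z - p.eval z) hx0 hx hs hint
      fun z hz => ?_
    rw [abs_sub_comm]
    exact (hp z hz).le
  filter_upwards [Metric.tendsto_nhds.1 (hpoly p) (ε / 4) (by linarith), hwint, hwpos, hs0]
    with s h1 h2 h3 h4
  have h5 : |(∫ y, f (Real.exp (-(s * y))) * (w y * Real.exp (-(s * y))) ∂μ)
        / (∫ y, w y * Real.exp (-(s * y)) ∂μ)
      - (∫ y, p.eval (Real.exp (-(s * y))) * (w y * Real.exp (-(s * y))) ∂μ)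
        / ∫ y, w y * Real.exp (-(s * y)) ∂μ| ≤ ε / 4 := by
    rw [← sub_div, abs_div, abs_of_pos h3, div_le_iff₀ h3]
    exact happrox μ w s hw0 hw h4 h2
  have h6 := happrox γ v 1 hv0 hv one_pos hvint
  rw [hvone, mul_one] at h6
  rw [Real.dist_eq] at h1 ⊢
  rw [abs_le] at h5 h6
  rw [abs_lt] at h1 ⊢
  constructor <;> linarith [h1.1, h1.2, h5.1, h5.2, h6.1, h6.2]

end Laplace

/-! ### The positive part of a tilted moment -/

/-- The weight `y ^ n * exp (r * y)` on the positive half-line. -/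
noncomputable def posWeight (n : ℕ) (r : ℝ) : ℝ → ℝ :=
  (Set.Ioi 0).indicator fun y => y ^ n * Real.exp (r * y)

section Moments

variable {μ : Measure ℝ} {r : ℝ}

lemma posWeight_nonneg (n : ℕ) (r y : ℝ) : 0 ≤ posWeight n r y := by
  refine Set.indicator_nonneg (fun z hz => ?_) y
  exact mul_nonneg (pow_nonneg (le_of_lt hz) n) (Real.exp_pos _).le

lemma posWeight_of_nonpos (n : ℕ) (r : ℝ) {y : ℝ} (hy : y ≤ 0) : posWeight n r y = 0 :=
  Set.indicator_of_notMem (by simpa using hy) _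

lemma posWeight_mul_exp (n : ℕ) (r s y : ℝ) : posWeight n r y * Real.exp (-(s * y))
    = (Set.Ioi 0).indicator (fun y => y ^ n * Real.exp ((r - s) * y)) y := by
  by_cases hy : y ∈ Set.Ioi (0 : ℝ)
  · rw [posWeight, Set.indicator_of_mem hy, Set.indicator_of_mem hy, mul_assoc, ← Real.exp_add]
    congr 2
    ring
  · rw [posWeight, Set.indicator_of_notMem hy, Set.indicator_of_notMem hy, zero_mul]

variable (hmem : Set.Ioo 0 r ⊆ interior (integrableExpSet id μ))
include hmem

lemma integrable_pow_mul_exp {s : ℝ} (hs : s ∈ Set.Ioo 0 r) (n : ℕ) :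
    Integrable (fun y => y ^ n * Real.exp ((r - s) * y)) μ :=
  integrable_pow_mul_exp_of_mem_interior_integrableExpSet (X := id)
    (hmem ⟨by linarith [hs.2], by linarith [hs.1]⟩) n

lemma integrable_posWeight {s : ℝ} (hs : s ∈ Set.Ioo 0 r) (n : ℕ) :
    Integrable (fun y => posWeight n r y * Real.exp (-(s * y))) μ := by
  simp only [posWeight_mul_exp]
  exact (integrable_pow_mul_exp hmem hs n).indicator measurableSet_Ioi

lemma integral_posWeight_anti {s t : ℝ} (hs : 0 < s) (hst : s ≤ t) (ht : t < r) (n : ℕ) :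
    ∫ y, posWeight n r y * Real.exp (-(t * y)) ∂μ
      ≤ ∫ y, posWeight n r y * Real.exp (-(s * y)) ∂μ := by
  refine integral_mono (integrable_posWeight hmem ⟨hs.trans_le hst, ht⟩ n)
    (integrable_posWeight hmem ⟨hs, hst.trans_lt ht⟩ n) fun y => ?_
  rcases le_or_gt y 0 with hy | hy
  · simp [posWeight_of_nonpos n r hy]
  · refine mul_le_mul_of_nonneg_left ?_ (posWeight_nonneg n r y)
    gcongr

/-- The contribution of the negative half-line to a tilted moment stays bounded as the tilt
approaches `r > 0`. -/
lemma exists_abs_moment_sub_integral_posWeight_le (n : ℕ) : ∃ C, ∀ s, 0 < s → s < r / 2 →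
    |(∫ y, y ^ n * Real.exp ((r - s) * y) ∂μ)
      - ∫ y, posWeight n r y * Real.exp (-(s * y)) ∂μ| ≤ C := by
  refine ⟨∫ y, |y| ^ n * Real.exp (r / 2 * y) ∂μ, fun s hs hs2 => ?_⟩
  have hsr : s ∈ Set.Ioo 0 r := ⟨hs, by linarith⟩
  rw [← integral_sub (integrable_pow_mul_exp hmem hsr n) (integrable_posWeight hmem hsr n),
    ← Real.norm_eq_abs]
  refine norm_integral_le_of_norm_le
    (integrable_pow_abs_mul_exp_of_mem_interior_integrableExpSet (X := id)
      (hmem (show r / 2 ∈ Set.Ioo 0 r from ⟨by linarith, by linarith⟩)) n)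
    (Eventually.of_forall fun y => ?_)
  rw [posWeight_mul_exp]
  by_cases hy : y ∈ Set.Ioi (0 : ℝ)
  · rw [Set.indicator_of_mem hy, sub_self, norm_zero]
    positivity
  · rw [Set.indicator_of_notMem hy, sub_zero, norm_mul, norm_pow, Real.norm_eq_abs,
      Real.norm_of_nonneg (Real.exp_pos _).le]
    have hy' : y ≤ 0 := by simpa using hy
    exact mul_le_mul_of_nonneg_left (Real.exp_le_exp.2 (by nlinarith)) (by positivity)

/-- Since its positive part is monotone and its negative part is bounded, a tilted moment that is
unbounded along a sequence tends to infinity. -/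
lemma tendsto_integral_posWeight_atTop (n : ℕ) {u : ℕ → ℝ} (hr : 0 < r)
    (hu : Tendsto u atTop (𝓝[>] 0))
    (hu' : Tendsto (fun j => ∫ y, y ^ n * Real.exp ((r - u j) * y) ∂μ) atTop atTop) :
    Tendsto (fun s => ∫ y, posWeight n r y * Real.exp (-(s * y)) ∂μ) (𝓝[>] 0) atTop := by
  obtain ⟨C, hC⟩ := exists_abs_moment_sub_integral_posWeight_le hmem n
  refine tendsto_atTop.2 fun A => ?_
  obtain ⟨j, hj, hjA⟩ := ((hu.eventually (Ioo_mem_nhdsGT (half_pos hr))).and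
    (hu'.eventually_ge_atTop (A + C))).exists
  filter_upwards [Ioo_mem_nhdsGT hj.1] with s hs
  have h1 := integral_posWeight_anti hmem hs.1 hs.2.le (by linarith [hj.2]) n
  have h2 := (abs_le.1 (hC (u j) hj.1 hj.2)).2
  linarith

lemma tendsto_moment_atTop (n : ℕ) {u : ℕ → ℝ} (hr : 0 < r)
    (hu : Tendsto u atTop (𝓝[>] 0))
    (hu' : Tendsto (fun j => ∫ y, y ^ n * Real.exp ((r - u j) * y) ∂μ) atTop atTop) :
    Tendsto (fun s => ∫ y, y ^ n * Real.exp ((r - s) * y) ∂μ) (𝓝[>] 0) atTop := by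
  obtain ⟨C, hC⟩ := exists_abs_moment_sub_integral_posWeight_le hmem n
  refine tendsto_atTop_mono' _ ?_ (tendsto_atTop_add_const_right _ (-C)
    (tendsto_integral_posWeight_atTop hmem n hr hu hu'))
  filter_upwards [Ioo_mem_nhdsGT (half_pos hr)] with s hs
  have := (abs_le.1 (hC s hs.1 hs.2)).1
  linarith

lemma regularlyVarying_integral_posWeight (n : ℕ) {ρ : ℝ} (hr : 0 < r)
    (htop : Tendsto (fun s => ∫ y, y ^ n * Real.exp ((r - s) * y) ∂μ) (𝓝[>] 0) atTop)
    (hvar : RegularlyVarying (fun s => ∫ y, y ^ n * Real.exp ((r - s) * y) ∂μ) ρ) :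
    RegularlyVarying (fun s => ∫ y, posWeight n r y * Real.exp (-(s * y)) ∂μ) ρ := by
  obtain ⟨C, hC⟩ := exists_abs_moment_sub_integral_posWeight_le hmem n
  refine hvar.of_isEquivalent (IsEquivalent.symm ?_)
  have hO : (fun s => (∫ y, posWeight n r y * Real.exp (-(s * y)) ∂μ)
      - ∫ y, y ^ n * Real.exp ((r - s) * y) ∂μ) =O[𝓝[>] 0] fun _ => (1 : ℝ) := by
    refine IsBigO.of_bound C ?_
    filter_upwards [Ioo_mem_nhdsGT (half_pos hr)] with s hs
    rw [norm_one, mul_one, Real.norm_eq_abs, abs_sub_comm]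
    exact hC s hs.1 hs.2
  refine IsEquivalent.symm (hO.trans_isLittleO ?_)
  exact isLittleO_const_left.2 (Or.inr (tendsto_norm_atTop_atTop.comp htop))

end Moments

/-! ### Tail lower bound from a regularly varying derivative -/

section TailI

/-- The density `u ^ (ρ - 1) / Γ(ρ)` on the positive half-line, whose Laplace transform is
`c ↦ c ^ (-ρ)`. -/
noncomputable def gammaWeight (ρ : ℝ) : ℝ → ℝ :=
  (Set.Ioi 0).indicator fun u => (Real.Gamma ρ)⁻¹ * u ^ (ρ - 1)

lemma gammaWeight_nonneg {ρ : ℝ} (hρ : 0 < ρ) (u : ℝ) : 0 ≤ gammaWeight ρ u := by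
  refine Set.indicator_nonneg (fun z hz => ?_) u
  exact mul_nonneg (inv_pos.2 (Real.Gamma_pos_of_pos hρ)).le (Real.rpow_nonneg (le_of_lt hz) _)

lemma gammaWeight_of_nonpos (ρ : ℝ) {u : ℝ} (hu : u ≤ 0) : gammaWeight ρ u = 0 :=
  Set.indicator_of_notMem (by simpa using hu) _

lemma gammaWeight_mul_exp (ρ c u : ℝ) : gammaWeight ρ u * Real.exp (-(c * u))
    = (Set.Ioi 0).indicator
      (fun u => (Real.Gamma ρ)⁻¹ * (u ^ (ρ - 1) * Real.exp (-(c * u)))) u := by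
  by_cases hu : u ∈ Set.Ioi (0 : ℝ)
  · rw [gammaWeight, Set.indicator_of_mem hu, Set.indicator_of_mem hu, mul_assoc]
  · rw [gammaWeight, Set.indicator_of_notMem hu, Set.indicator_of_notMem hu, zero_mul]

lemma integral_gammaWeight_mul_exp {ρ c : ℝ} (hρ : 0 < ρ) (hc : 0 < c) :
    ∫ u, gammaWeight ρ u * Real.exp (-(c * u)) = c ^ (-ρ) := by
  simp only [gammaWeight_mul_exp]
  rw [integral_indicator measurableSet_Ioi, integral_const_mul,
    Real.integral_rpow_mul_exp_neg_mul_Ioi hρ hc, one_div, Real.inv_rpow hc.le,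
    ← Real.rpow_neg hc.le]
  have := (Real.Gamma_pos_of_pos hρ).ne'
  field_simp

lemma integrable_gammaWeight_mul_exp {ρ : ℝ} (hρ : 0 < ρ) :
    Integrable fun u => gammaWeight ρ u * Real.exp (-(1 * u)) := by
  refine Integrable.of_integral_ne_zero ?_
  rw [integral_gammaWeight_mul_exp hρ one_pos]
  exact (Real.rpow_pos_of_pos one_pos _).ne'

/-- A continuous bump that, for `a ≤ b`, is positive exactly on `(a, b)`. -/
def bump (a b x : ℝ) : ℝ := max 0 ((x - a) * (b - x))

lemma continuous_bump (a b : ℝ) : Continuous (bump a b) := by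
  unfold bump
  fun_prop

lemma bump_nonneg (a b x : ℝ) : 0 ≤ bump a b x := le_max_left _ _

lemma bump_pos {a b x : ℝ} (hx : x ∈ Set.Ioo a b) : 0 < bump a b x :=
  lt_max_of_lt_right (mul_pos (sub_pos.2 hx.1) (sub_pos.2 hx.2))

lemma bump_eq_zero {a b x : ℝ} (hab : a ≤ b) (hx : x ∉ Set.Ioo a b) : bump a b x = 0 := by
  refine max_eq_left ?_
  rcases le_or_gt x a with h | h
  · exact mul_nonpos_of_nonpos_of_nonneg (by linarith) (by linarith)
  · have : b ≤ x := not_lt.1 fun h' => hx ⟨h, h'⟩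
    exact mul_nonpos_of_nonneg_of_nonpos (by linarith) (by linarith)

lemma bump_le_one {a b x : ℝ} (ha : 0 ≤ a) (hab : a ≤ b) (hb : b ≤ 1) (hx : x ∈ Set.Icc (0 : ℝ) 1) :
    bump a b x ≤ 1 := by
  refine max_le zero_le_one ?_
  rcases le_or_gt x a with h | h
  · exact (mul_nonpos_of_nonpos_of_nonneg (by linarith) (by linarith)).trans zero_le_one
  · nlinarith [hx.1, hx.2]

lemma integral_bump_gammaWeight_pos {ρ β : ℝ} (hρ : 0 < ρ) (hβ : 1 < β) :
    0 < ∫ u, bump (Real.exp (-β)) (Real.exp (-1)) (Real.exp (-(1 * u)))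
      * (gammaWeight ρ u * Real.exp (-(1 * u))) := by
  refine (integral_pos_iff_support_of_nonneg (fun u => mul_nonneg (bump_nonneg _ _ _)
    (mul_nonneg (gammaWeight_nonneg hρ u) (Real.exp_pos _).le))
    (integrable_comp_exp_neg_mul (fun u hu => gammaWeight_of_nonpos ρ hu) (gammaWeight_nonneg hρ)
      one_pos (integrable_gammaWeight_mul_exp hρ) (continuous_bump _ _))).2 ?_
  have hsub : Set.Ioo 1 β ⊆ Function.support fun u =>
      bump (Real.exp (-β)) (Real.exp (-1)) (Real.exp (-(1 * u)))
      * (gammaWeight ρ u * Real.exp (-(1 * u))) := by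
    intro u hu
    have hu0 : (0 : ℝ) < u := one_pos.trans hu.1
    refine (mul_pos (bump_pos ⟨?_, ?_⟩) (mul_pos ?_ (Real.exp_pos _))).ne'
    · rw [Real.exp_lt_exp]; linarith [hu.2]
    · rw [Real.exp_lt_exp]; linarith [hu.1]
    · rw [gammaWeight, Set.indicator_of_mem (show u ∈ Set.Ioi 0 from hu0)]
      exact mul_pos (inv_pos.2 (Real.Gamma_pos_of_pos hρ)) (Real.rpow_pos_of_pos hu0 _)
  refine lt_of_lt_of_le ?_ (measure_mono hsub)
  simpa using hβ

variable {μ : Measure ℝ} [IsProbabilityMeasure μ] {r : ℝ}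

/-- The bump localizes the tilted moment to `1 / s < y < β / s`, where the weight is at most
`(β / s) ^ n * exp (r * β / s)`. -/
lemma integral_bump_posWeight_le {β s : ℝ} (hr : 0 < r) (hβ : 1 < β) (hs : 0 < s) (n : ℕ) :
    ∫ y, bump (Real.exp (-β)) (Real.exp (-1)) (Real.exp (-(s * y)))
      * (posWeight n r y * Real.exp (-(s * y))) ∂μ
    ≤ (β / s) ^ n * Real.exp (r * (β / s)) * μ.real (Set.Ioi (1 / s)) := by
  have hβ0 : 0 < β := one_pos.trans hβ
  rw [mul_comm _ (μ.real _), ← smul_eq_mul, ← integral_indicator_const _ measurableSet_Ioi]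
  refine integral_mono_of_nonneg (Eventually.of_forall fun y => mul_nonneg (bump_nonneg _ _ _)
    (mul_nonneg (posWeight_nonneg n r y) (Real.exp_pos _).le))
    ((integrable_const _).indicator measurableSet_Ioi) (Eventually.of_forall fun y => ?_)
  have hnn : 0 ≤ (Set.Ioi (1 / s)).indicator
      (fun _ => (β / s) ^ n * Real.exp (r * (β / s))) y :=
    Set.indicator_nonneg (fun _ _ => by positivity) y
  by_cases hy : 1 < s * y ∧ s * y < β
  · have hy0 : 0 < y := by
      by_contra h
      nlinarith [hy.1]
    have hy1 : 1 / s < y := by rw [div_lt_iff₀ hs]; linarith [hy.1]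
    have hy2 : y ≤ β / s := by rw [le_div_iff₀ hs]; linarith [hy.2]
    have hle1 : Real.exp (-(s * y)) ≤ 1 := Real.exp_le_one_iff.2 (by linarith [hy.1])
    have hb := bump_le_one (a := Real.exp (-β)) (b := Real.exp (-1)) (Real.exp_pos _).le
      (Real.exp_le_exp.2 (by linarith)) (Real.exp_le_one_iff.2 (by norm_num))
      (x := Real.exp (-(s * y))) ⟨(Real.exp_pos _).le, hle1⟩
    simp only []
    rw [Set.indicator_of_mem (show y ∈ Set.Ioi (1 / s) from hy1)]
    have hw : posWeight n r y = y ^ n * Real.exp (r * y) :=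
      Set.indicator_of_mem (show y ∈ Set.Ioi 0 from hy0) _
    calc _ ≤ 1 * (posWeight n r y * 1) := by
          have := posWeight_nonneg n r y
          gcongr
      _ = y ^ n * Real.exp (r * y) := by rw [one_mul, mul_one, hw]
      _ ≤ _ := by gcongr
  · have hz : bump (Real.exp (-β)) (Real.exp (-1)) (Real.exp (-(s * y))) = 0 := by
      refine bump_eq_zero (Real.exp_le_exp.2 (by linarith)) fun h => hy ?_
      have h1 := Real.exp_lt_exp.1 h.1
      have h2 := Real.exp_lt_exp.1 h.2
      exact ⟨by linarith, by linarith⟩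
    simp only [hz, zero_mul]
    exact hnn

lemma eventually_exp_le_of_moment (hr : 0 < r)
    (hmem : Set.Ioo 0 r ⊆ interior (integrableExpSet id μ)) (n : ℕ) {ρ : ℝ} (hρ : 0 < ρ)
    (hvar : RegularlyVarying (fun s => ∫ y, y ^ n * Real.exp ((r - s) * y) ∂μ) ρ)
    {ε : ℝ} (hε : 0 < ε) :
    ∀ᶠ x in atTop, Real.exp (-(r + ε) * x) ≤ μ.real (Set.Ioi x) := by
  obtain ⟨u, hu, hu'⟩ := hvar.exists_seq_tendsto_atTop hρ
  have htopH := tendsto_integral_posWeight_atTop hmem n hr hu hu'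
  have hvarH := regularlyVarying_integral_posWeight hmem n hr
    (tendsto_moment_atTop hmem n hr hu hu') hvar
  have hβ : 1 < 1 + ε / (2 * r) := by
    have : 0 < ε / (2 * r) := by positivity
    linarith
  set β := 1 + ε / (2 * r) with hβdef
  have hβ0 : 0 < β := one_pos.trans hβ
  have hlim := tendsto_integral_comp_exp_neg_mul (μ := μ) (γ := volume)
    (fun y hy => posWeight_of_nonpos n r hy) (posWeight_nonneg n r)
    (fun u hu => gammaWeight_of_nonpos ρ hu) (gammaWeight_nonneg hρ)
    (by filter_upwards [Ioo_mem_nhdsGT hr] with s hs using integrable_posWeight hmem hs n)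
    hvarH.1 (integrable_gammaWeight_mul_exp hρ)
    (by rw [integral_gammaWeight_mul_exp hρ one_pos, Real.one_rpow])
    (fun m => by
      have hm : (0 : ℝ) < m + 1 := by positivity
      rw [integral_gammaWeight_mul_exp hρ hm]
      exact hvarH.2 _ hm)
    (continuous_bump (Real.exp (-β)) (Real.exp (-1)))
  have hpos := integral_bump_gammaWeight_pos hρ hβ
  set B := ∫ u, bump (Real.exp (-β)) (Real.exp (-1)) (Real.exp (-(1 * u)))
      * (gammaWeight ρ u * Real.exp (-(1 * u)))
  have hone : ∀ᶠ s in 𝓝[>] (0 : ℝ),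
      1 ≤ (β / s) ^ n * Real.exp (r * (β / s)) * μ.real (Set.Ioi (1 / s)) := by
    filter_upwards [hlim.eventually (lt_mem_nhds (half_lt_self hpos)), hvarH.1,
      htopH.eventually_ge_atTop (2 / B), self_mem_nhdsWithin] with s h1 h2 h3 h4
    refine le_trans ?_ (integral_bump_posWeight_le hr hβ h4 n)
    rw [lt_div_iff₀ h2] at h1
    refine le_trans ?_ h1.le
    calc (1 : ℝ) = B / 2 * (2 / B) := by field_simp
      _ ≤ _ := by gcongr
  have hpow : ∀ᶠ x : ℝ in atTop, (β * x) ^ n ≤ Real.exp (ε / 2 * x) := by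
    have h := (isLittleO_pow_exp_pos_mul_atTop n (half_pos hε)).bound
      (show 0 < (β ^ n)⁻¹ by positivity)
    filter_upwards [h, eventually_gt_atTop 0] with x hx hx0
    rw [Real.norm_of_nonneg (by positivity), Real.norm_of_nonneg (by positivity)] at hx
    rw [mul_pow]
    calc β ^ n * x ^ n ≤ β ^ n * ((β ^ n)⁻¹ * Real.exp (ε / 2 * x)) := by gcongr
      _ = _ := by field_simp
  filter_upwards [tendsto_inv_atTop_nhdsGT_zero.eventually hone, hpow, eventually_gt_atTop 0]
    with x h1 h2 h3
  rw [div_inv_eq_mul, one_div, inv_inv] at h1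
  have hexp : Real.exp (ε / 2 * x) * Real.exp (r * (β * x)) = Real.exp ((r + ε) * x) := by
    rw [← Real.exp_add]
    congr 1
    rw [hβdef]
    field_simp
    ring
  have h4 : 1 ≤ Real.exp ((r + ε) * x) * μ.real (Set.Ioi x) := by
    rw [← hexp]
    exact h1.trans (by gcongr)
  rw [neg_mul, Real.exp_neg, inv_le_iff_one_le_mul₀ (Real.exp_pos _)]
  linarith

end TailI

/-! ### Tail lower bound from a regularly varying logarithm -/

section TailII

/-- Passing from thresholds parametrized continuously by `s → 0+` to all large thresholds. -/
lemma eventually_atTop_of_eventually_nhdsGT {G : ℝ → ℝ} {r : ℝ} (hr : 0 < r)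
    (hG : ContinuousOn G (Set.Ioo 0 r)) (hGtop : Tendsto G (𝓝[>] 0) atTop) {P : ℝ → Prop}
    (hP : ∀ᶠ s in 𝓝[>] 0, P (G s)) : ∀ᶠ x in atTop, P x := by
  obtain ⟨s₁, hs₁, hs⟩ := mem_nhdsGT_iff_exists_Ioc_subset.1 (inter_mem hP (Ioo_mem_nhdsGT hr))
  have hs₁' : (0 : ℝ) < s₁ := hs₁
  have hl : 𝓝[>] (0 : ℝ) ≤ 𝓟 (Set.Ioc 0 s₁) := le_principal_iff.2 (Ioc_mem_nhdsGT hs₁')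
  have himage := isPreconnected_Ioc.intermediate_value_Ici (⟨hs₁', le_rfl⟩ : s₁ ∈ Set.Ioc 0 s₁) hl
    (hG.mono fun s h => (hs h).2) hGtop
  filter_upwards [eventually_ge_atTop (G s₁)] with x hx
  obtain ⟨s, hs', rfl⟩ := himage hx
  exact (hs hs').1

lemma hasDerivAt_one_sub_rpow_sub (ρ θ : ℝ) :
    HasDerivAt (fun t : ℝ => (1 - t) ^ (-ρ) - t * (ρ * θ)) (ρ * (1 - θ)) 0 := by
  have h1 : HasDerivAt (fun t : ℝ => (1 - t) ^ (-ρ)) (-1 * (-ρ) * (1 - 0) ^ (-ρ - 1)) 0 :=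
    ((hasDerivAt_id (0 : ℝ)).const_sub 1).rpow_const (Or.inl (by norm_num))
  refine (h1.sub ((hasDerivAt_id (0 : ℝ)).mul_const (ρ * θ))).congr_deriv ?_
  rw [sub_zero, Real.one_rpow]
  ring

lemma exists_pos_rpow_lt {ρ θ : ℝ} (hρ : 0 < ρ) (hθ : 1 < θ) :
    ∃ t, 0 < t ∧ t < 1 ∧ (1 - t) ^ (-ρ) < 1 + t * (ρ * θ) := by
  have h := (hasDerivAt_iff_tendsto_slope.1 (hasDerivAt_one_sub_rpow_sub ρ θ)).mono_left
    (nhdsGT_le_nhdsNE 0)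
  have hev := h.eventually (gt_mem_nhds (show ρ * (1 - θ) < 0 by nlinarith))
  obtain ⟨t, ht, ht1⟩ := (hev.and (Ioo_mem_nhdsGT one_pos)).exists
  refine ⟨t, ht1.1, ht1.2, ?_⟩
  simp only [slope_def_field, sub_zero, Real.one_rpow, zero_mul] at ht
  rw [div_lt_iff₀ ht1.1] at ht
  linarith

lemma exists_neg_rpow_lt {ρ θ : ℝ} (hρ : 0 < ρ) (hθ : θ < 1) :
    ∃ t, t < 0 ∧ (1 - t) ^ (-ρ) < 1 + t * (ρ * θ) := by
  have h := (hasDerivAt_iff_tendsto_slope.1 (hasDerivAt_one_sub_rpow_sub ρ θ)).mono_left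
    (nhdsLT_le_nhdsNE 0)
  have hev := h.eventually (lt_mem_nhds (show 0 < ρ * (1 - θ) by nlinarith))
  obtain ⟨t, ht, ht1⟩ := (hev.and self_mem_nhdsWithin).exists
  have ht0 : t < 0 := ht1
  refine ⟨t, ht0, ?_⟩
  simp only [slope_def_field, sub_zero, Real.one_rpow, zero_mul] at ht
  rw [lt_div_iff_of_neg ht0] at ht
  linarith

variable {μ : Measure ℝ} [IsProbabilityMeasure μ] {r : ℝ}

/-- Chernoff bound under the exponentially tilted measure: the half-line starting (for `t > 0`) or
ending (for `t < 0`) at `θ` times `ρ * log M(r - s) / s` carries at most a quarter of the tilted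
mass `M(r - s)`. -/
lemma eventually_setIntegral_exp_le (hr : 0 < r)
    (hmem : Set.Ioo 0 r ⊆ interior (integrableExpSet id μ)) {ρ t θ : ℝ}
    (hvar : RegularlyVarying (fun s => Real.log (mgf id μ (r - s))) ρ)
    (htop : Tendsto (fun s => Real.log (mgf id μ (r - s))) (𝓝[>] 0) atTop)
    (ht : t < 1) (htθ : (1 - t) ^ (-ρ) < 1 + t * (ρ * θ)) :
    ∀ᶠ s in 𝓝[>] 0,
      ∫ y in {y | 0 ≤ t * (y - θ * (ρ * Real.log (mgf id μ (r - s)) / s))},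
        Real.exp ((r - s) * y) ∂μ ≤ mgf id μ (r - s) / 4 := by
  have ht' : 0 < 1 - t := by linarith
  obtain ⟨K, hK1, hK2⟩ := exists_between htθ
  have hη : 0 < 1 + t * (ρ * θ) - K := by linarith
  have hm := tendsto_const_mul_nhdsGT_zero ht'
  filter_upwards [(hvar.2 (1 - t) ht').eventually (gt_mem_nhds hK1), hvar.1, Ioo_mem_nhdsGT hr,
    hm.eventually (Ioo_mem_nhdsGT hr),
    (htop.const_mul_atTop hη).eventually_ge_atTop (Real.log 4)] with s h1 h2 h3 h4 h5
  have hs : 0 < s := h3.1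
  have hint : ∀ c ∈ Set.Ioo 0 r, Integrable (fun y => Real.exp ((r - c) * y)) μ := by
    intro c hc
    simpa using integrable_pow_mul_exp hmem hc 0
  have hexp : ∀ c ∈ Set.Ioo 0 r,
      Real.exp (Real.log (mgf id μ (r - c))) = mgf id μ (r - c) := by
    intro c hc
    exact Real.exp_log (mgf_pos (hint c hc))
  set Λ := Real.log (mgf id μ (r - s)) with hΛ
  set z := θ * (ρ * Λ / s) with hz
  rw [div_lt_iff₀ h2] at h1
  have hmeas : MeasurableSet {y : ℝ | 0 ≤ t * (y - z)} :=
    measurableSet_le measurable_const (by fun_prop)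
  rw [← integral_indicator hmeas]
  calc ∫ y, Set.indicator {y | 0 ≤ t * (y - z)} (fun y => Real.exp ((r - s) * y)) y ∂μ
      ≤ ∫ y, Real.exp (-(t * s * z)) * Real.exp ((r - (1 - t) * s) * y) ∂μ := by
        refine integral_mono ((hint s h3).indicator hmeas) ((hint _ h4).const_mul _) fun y => ?_
        by_cases hy : y ∈ {y : ℝ | 0 ≤ t * (y - z)}
        · rw [Set.indicator_of_mem hy, ← Real.exp_add, Real.exp_le_exp]
          have : 0 ≤ s * (t * (y - z)) := mul_nonneg hs.le hy
          linarith
        · rw [Set.indicator_of_notMem hy]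
          positivity
    _ = Real.exp (-(t * s * z)) * mgf id μ (r - (1 - t) * s) := by
        rw [integral_const_mul]
        rfl
    _ = Real.exp (Real.log (mgf id μ (r - (1 - t) * s)) - t * (ρ * θ) * Λ) := by
        rw [← hexp _ h4, ← Real.exp_add, Real.log_exp]
        congr 1
        rw [hz]
        field_simp
        ring
    _ ≤ Real.exp (Λ - Real.log 4) := by
        rw [Real.exp_le_exp]
        linarith
    _ = mgf id μ (r - s) / 4 := by
        rw [Real.exp_sub, hΛ, hexp s h3, Real.exp_log (by norm_num)]

lemma eventually_exp_le_of_log_mgf (hr : 0 < r)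
    (hmem : Set.Ioo 0 r ⊆ interior (integrableExpSet id μ)) {ρ : ℝ} (hρ : 0 < ρ)
    (hvar : RegularlyVarying (fun s => Real.log (mgf id μ (r - s))) ρ)
    {ε : ℝ} (hε : 0 < ε) :
    ∀ᶠ x in atTop, Real.exp (-(r + ε) * x) ≤ μ.real (Set.Ioi x) := by
  have hint : ∀ s ∈ Set.Ioo 0 r, Integrable (fun y => Real.exp ((r - s) * y)) μ := by
    intro s hs
    simpa using integrable_pow_mul_exp hmem hs 0
  have hmgf : ∀ s, ∫ y, y ^ 0 * Real.exp ((r - s) * y) ∂μ = mgf id μ (r - s) := by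
    intro s
    simp [mgf]
  have htopM : Tendsto (fun s => mgf id μ (r - s)) (𝓝[>] 0) atTop := by
    obtain ⟨u, hu, hu'⟩ := hvar.exists_seq_tendsto_atTop hρ
    have h := tendsto_moment_atTop hmem 0 hr hu (by
      simp only [hmgf]
      refine (Real.tendsto_exp_atTop.comp hu').congr' ?_
      filter_upwards [hu.eventually (Ioo_mem_nhdsGT hr)] with j hj
      exact Real.exp_log (mgf_pos (hint _ hj)))
    simpa only [hmgf] using h
  have htop := Real.tendsto_log_atTop.comp htopM
  -- the tilted law concentrates around `ρ log M(r - s) / s`, up to a factor `β`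
  have hε' : 1 < 1 + ε / r := by
    have : 0 < ε / r := by positivity
    linarith
  have hβ2 : √(1 + ε / r) ^ 2 = 1 + ε / r := Real.sq_sqrt (by linarith)
  set β := √(1 + ε / r)
  have hβ0 : 0 ≤ β := Real.sqrt_nonneg _
  have hβ : 1 < β := by nlinarith
  obtain ⟨t₁, ht₁, ht₁', ht₁θ⟩ := exists_pos_rpow_lt hρ hβ
  obtain ⟨t₂, ht₂, ht₂θ⟩ := exists_neg_rpow_lt hρ (show β⁻¹ < 1 from inv_lt_one_of_one_lt₀ hβ)
  refine eventually_atTop_of_eventually_nhdsGT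
    (G := fun s => β⁻¹ * (ρ * Real.log (mgf id μ (r - s)) / s)) hr ?_ ?_ ?_
  · have hM : ContinuousOn (fun s => mgf id μ (r - s)) (Set.Ioo 0 r) :=
      continuousOn_mgf.comp (by fun_prop) fun s hs => hmem ⟨by linarith [hs.2], by linarith [hs.1]⟩
    exact continuousOn_const.mul ((continuousOn_const.mul
      (hM.log fun s hs => (mgf_pos (hint s hs)).ne')).div continuousOn_id fun s hs => hs.1.ne')
  · refine Tendsto.const_mul_atTop (by positivity) ?_
    simp only [div_eq_mul_inv]
    exact (htop.const_mul_atTop hρ).atTop_mul_atTop₀ tendsto_inv_nhdsGT_zero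
  · filter_upwards [eventually_setIntegral_exp_le hr hmem hvar htop ht₁' ht₁θ,
      eventually_setIntegral_exp_le hr hmem hvar htop (by linarith) ht₂θ, Ioo_mem_nhdsGT hr,
      htopM.eventually_ge_atTop 2, hvar.1] with s h1 h2 h3 h4 h5
    have hs : 0 < s := h3.1
    set m := ρ * Real.log (mgf id μ (r - s)) / s
    have hm : 0 < m := by positivity
    set f : ℝ → ℝ := fun y => Real.exp ((r - s) * y) with hf
    have hfint : Integrable f μ := hint s h3
    have hfpos : ∀ y, 0 ≤ f y := fun y => (Real.exp_pos _).le
    set A := {y : ℝ | 0 ≤ t₁ * (y - β * m)}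
    set B := {y : ℝ | 0 ≤ t₂ * (y - β⁻¹ * m)}
    have hA : MeasurableSet A := measurableSet_le measurable_const (by fun_prop)
    have hB : MeasurableSet B := measurableSet_le measurable_const (by fun_prop)
    have hAB : Integrable (fun y => A.indicator f y + B.indicator f y) μ :=
      (hfint.indicator hA).add (hfint.indicator hB)
    have hbound : mgf id μ (r - s) ≤ (∫ y in A, f y ∂μ) + (∫ y in B, f y ∂μ)
        + Real.exp (r * (β * m)) * μ.real (Set.Ioi (β⁻¹ * m)) := by
      rw [mul_comm (Real.exp _), ← smul_eq_mul, ← integral_indicator_const _ measurableSet_Ioi,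
        ← integral_indicator hA, ← integral_indicator hB,
        ← integral_add (hfint.indicator hA) (hfint.indicator hB),
        ← integral_add hAB ((integrable_const _).indicator measurableSet_Ioi)]
      refine integral_mono hfint
        (hAB.add ((integrable_const _).indicator measurableSet_Ioi)) fun y => ?_
      have hA0 : 0 ≤ A.indicator f y := Set.indicator_nonneg (fun z _ => hfpos z) y
      have hB0 : 0 ≤ B.indicator f y := Set.indicator_nonneg (fun z _ => hfpos z) y
      have hI0 : 0 ≤ (Set.Ioi (β⁻¹ * m)).indicator (fun _ => Real.exp (r * (β * m))) y :=
        Set.indicator_nonneg (fun z _ => (Real.exp_pos _).le) y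
      change f y ≤ A.indicator f y + B.indicator f y
        + (Set.Ioi (β⁻¹ * m)).indicator (fun _ => Real.exp (r * (β * m))) y
      by_cases hyA : y ∈ A
      · rw [Set.indicator_of_mem hyA]
        linarith
      by_cases hyB : y ∈ B
      · rw [Set.indicator_of_mem hyB]
        linarith
      have hy1 : y < β * m := by
        by_contra hcon
        exact hyA (mul_nonneg ht₁.le (by linarith))
      have hy2 : β⁻¹ * m < y := by
        by_contra hcon
        exact hyB (mul_nonneg_of_nonpos_of_nonpos ht₂.le (by linarith))
      have hy0 : 0 < y := lt_trans (by positivity) hy2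
      have hfy : f y ≤ Real.exp (r * (β * m)) := by
        rw [hf, Real.exp_le_exp]
        have h6 : (r - s) * y ≤ r * y := by nlinarith
        have h7 : r * y ≤ r * (β * m) := by gcongr
        linarith
      rw [Set.indicator_of_mem (show y ∈ Set.Ioi (β⁻¹ * m) from hy2)]
      linarith
    have h6 : 1 ≤ Real.exp (r * (β * m)) * μ.real (Set.Ioi (β⁻¹ * m)) := by linarith
    have h7 : r * (β * m) = (r + ε) * (β⁻¹ * m) := by
      have : r * β ^ 2 = r + ε := by rw [hβ2]; field_simp
      have hβne : β ≠ 0 := by positivity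
      rw [← this]
      field_simp
    rw [h7] at h6
    rw [neg_mul, Real.exp_neg, inv_le_iff_one_le_mul₀ (Real.exp_pos _)]
    linarith

end TailII

/-! ### Exponential rates of prices -/

section Prices

variable {μ : Measure ℝ} {r : ℝ}

lemma Ioo_subset_interior_integrableExpSet [IsProbabilityMeasure μ]
    (hr : IsLUB (integrableExpSet id μ) r) :
    Set.Ioo 0 r ⊆ interior (integrableExpSet id μ) := by
  refine interior_maximal (fun t ht => ?_) isOpen_Ioo
  obtain ⟨u, hu, htu, -⟩ := hr.exists_between ht.2
  have h0 : (0 : ℝ) ∈ integrableExpSet id μ := by simp [integrableExpSet]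
  exact convex_integrableExpSet.ordConnected.out h0 hu ⟨ht.1.le, htu.le⟩

lemma eventually_exp_le_of_criterion [IsProbabilityMeasure μ] (hr : 0 < r)
    (hlub : IsLUB (integrableExpSet id μ) r)
    (hcrit : CriterionIRight μ r ∨ CriterionIIRight μ r) {ε : ℝ} (hε : 0 < ε) :
    ∀ᶠ x in atTop, Real.exp (-(r + ε) * x) ≤ μ.real (Set.Ioi x) := by
  have hmem := Ioo_subset_interior_integrableExpSet hlub
  rcases hcrit with ⟨n, h⟩ | h
  · obtain ⟨ρ, hρ, hvar⟩ := h.exists_regularlyVarying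
    refine eventually_exp_le_of_moment hr hmem n hρ (hvar.of_isEquivalent ?_) hε
    refine EventuallyEq.isEquivalent ?_
    filter_upwards [Ioo_mem_nhdsGT hr] with s hs
    exact (iteratedDeriv_mgf (X := id)
      (hmem ⟨by linarith [hs.2], by linarith [hs.1]⟩) n).symm
  · obtain ⟨ρ, hρ, hvar⟩ := h.exists_regularlyVarying
    exact eventually_exp_le_of_log_mgf hr hmem hρ hvar hε

lemma tendsto_exp_neg_mul_atTop {a : ℝ} (ha : 0 < a) :
    Tendsto (fun k => Real.exp (-a * k)) atTop (𝓝 0) :=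
  Real.tendsto_exp_atBot.comp (tendsto_id.const_mul_atTop_of_neg (neg_lt_zero.2 ha))

/-- Slightly decreasing the exponent absorbs any positive constant. -/
lemma eventually_const_mul_exp_le (C : ℝ) {a b : ℝ} (hab : a < b) :
    ∀ᶠ k in atTop, C * Real.exp (-b * k) ≤ Real.exp (-a * k) := by
  have h := (tendsto_exp_neg_mul_atTop (sub_pos.2 hab)).const_mul C
  rw [mul_zero] at h
  filter_upwards [h.eventually (gt_mem_nhds one_pos)] with k hk
  have e : Real.exp (-b * k) = Real.exp (-(b - a) * k) * Real.exp (-a * k) := by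
    rw [← Real.exp_add]
    congr 1
    ring
  rw [e, ← mul_assoc]
  exact mul_le_of_le_one_left (Real.exp_pos _).le hk.le

lemma eventually_exp_le_const_mul_measure_Ioi_add_one
    (htail : ∀ ε > 0, ∀ᶠ x in atTop, Real.exp (-(r + ε) * x) ≤ μ.real (Set.Ioi x))
    {c ε : ℝ} (hc : 0 < c) (hε : 0 < ε) :
    ∀ᶠ k in atTop, Real.exp (-(r + ε) * k) ≤ c * μ.real (Set.Ioi (k + 1)) := by
  have h1 := (tendsto_atTop_add_const_right atTop (1 : ℝ) tendsto_id).eventually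
    (htail (ε / 2) (half_pos hε))
  filter_upwards [h1, eventually_const_mul_exp_le (c * Real.exp (-(r + ε / 2)))⁻¹
    (show r + ε / 2 < r + ε by linarith)] with k h2 h3
  simp only [id] at h2
  have hD : 0 < c * Real.exp (-(r + ε / 2)) := by positivity
  rw [inv_mul_le_iff₀ hD] at h3
  have e : Real.exp (-(r + ε / 2) * (k + 1))
      = Real.exp (-(r + ε / 2)) * Real.exp (-(r + ε / 2) * k) := by
    rw [← Real.exp_add]
    congr 1
    ring
  rw [e] at h2
  refine h3.trans ?_
  rw [mul_assoc]
  gcongr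

lemma le_callPrice [IsProbabilityMeasure μ] (hint : Integrable Real.exp μ) (k : ℝ) :
    Real.exp k * ((Real.exp 1 - 1) * μ.real (Set.Ioi (k + 1))) ≤ callPrice μ k := by
  rw [callPrice, ← integral_indicator measurableSet_Ioi]
  have e : Real.exp k * ((Real.exp 1 - 1) * μ.real (Set.Ioi (k + 1)))
      = ∫ x, (Set.Ioi (k + 1)).indicator (fun _ => Real.exp k * (Real.exp 1 - 1)) x ∂μ := by
    rw [integral_indicator_const _ measurableSet_Ioi, smul_eq_mul]
    ring
  rw [e]
  refine integral_mono ((integrable_const _).indicator measurableSet_Ioi)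
    ((hint.sub (integrable_const _)).indicator measurableSet_Ioi) fun x => ?_
  by_cases hx : x ∈ Set.Ioi (k + 1)
  · have hx1 : k + 1 < x := hx
    rw [Set.indicator_of_mem hx, Set.indicator_of_mem (show x ∈ Set.Ioi k from by
      simp only [Set.mem_Ioi]; linarith), mul_sub, ← Real.exp_add, mul_one]
    have := Real.exp_le_exp.2 hx1.le
    linarith
  · rw [Set.indicator_of_notMem hx]
    exact Set.indicator_nonneg (fun y hy => sub_nonneg.2 (Real.exp_le_exp.2 (le_of_lt hy))) x

lemma callPrice_le {t : ℝ} (ht : 1 ≤ t) (hint : t ∈ integrableExpSet id μ) (k : ℝ) :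
    callPrice μ k ≤ mgf id μ t * Real.exp (-(t - 1) * k) := by
  rw [callPrice, ← integral_indicator measurableSet_Ioi, mul_comm, mgf, ← integral_const_mul]
  refine integral_mono_of_nonneg (Eventually.of_forall fun x => Set.indicator_nonneg
    (fun y hy => sub_nonneg.2 (Real.exp_le_exp.2 (le_of_lt hy))) x) (hint.const_mul _)
    (Eventually.of_forall fun x => ?_)
  by_cases hx : x ∈ Set.Ioi k
  · have hx1 : k < x := hx
    simp only [Set.indicator_of_mem hx, id, ← Real.exp_add]
    have h1 : Real.exp x ≤ Real.exp (-(t - 1) * k + t * x) := by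
      rw [Real.exp_le_exp]
      nlinarith
    linarith [Real.exp_pos k]
  · simp only [Set.indicator_of_notMem hx]
    positivity

/-- The price, in units of its strike `exp (-k)`, of a put with log-strike `-k`, when `μ` is the law
of the negative log-return. -/
noncomputable def putPrice (μ : Measure ℝ) (k : ℝ) : ℝ :=
  ∫ y in Set.Ici k, (1 - Real.exp (k - y)) ∂μ

lemma integrableOn_one_sub_exp [IsProbabilityMeasure μ] (k : ℝ) :
    IntegrableOn (fun y => 1 - Real.exp (k - y)) (Set.Ici k) μ := by
  refine Measure.integrableOn_of_bounded (M := 1) (measure_ne_top _ _)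
    (by fun_prop : Continuous fun y : ℝ => 1 - Real.exp (k - y)).aestronglyMeasurable ?_
  filter_upwards [ae_restrict_mem measurableSet_Ici] with y hy
  have hy' : k ≤ y := hy
  have h1 : Real.exp (k - y) ≤ 1 := Real.exp_le_one_iff.2 (by linarith)
  rw [Real.norm_of_nonneg (by linarith)]
  linarith [Real.exp_pos (k - y)]

lemma le_putPrice [IsProbabilityMeasure μ] (k : ℝ) :
    (1 - Real.exp (-1)) * μ.real (Set.Ioi (k + 1)) ≤ putPrice μ k := by
  rw [putPrice, ← integral_indicator measurableSet_Ici, mul_comm, ← smul_eq_mul,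
    ← integral_indicator_const _ measurableSet_Ioi]
  refine integral_mono ((integrable_const _).indicator measurableSet_Ioi)
    ((integrableOn_one_sub_exp k).integrable_indicator measurableSet_Ici) fun x => ?_
  by_cases hx : x ∈ Set.Ioi (k + 1)
  · have hx1 : k + 1 < x := hx
    rw [Set.indicator_of_mem hx, Set.indicator_of_mem (show x ∈ Set.Ici k from by
      simp only [Set.mem_Ici]; linarith)]
    have := Real.exp_le_exp.2 (show k - x ≤ -1 by linarith)
    linarith
  · rw [Set.indicator_of_notMem hx]
    refine Set.indicator_nonneg (fun y hy => ?_) x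
    have hy' : k ≤ y := hy
    exact sub_nonneg.2 (Real.exp_le_one_iff.2 (by linarith))

lemma putPrice_le {t : ℝ} (ht : 0 ≤ t) (hint : t ∈ integrableExpSet id μ) (k : ℝ) :
    putPrice μ k ≤ mgf id μ t * Real.exp (-t * k) := by
  rw [putPrice, ← integral_indicator measurableSet_Ici, mul_comm, mgf, ← integral_const_mul]
  refine integral_mono_of_nonneg (Eventually.of_forall fun x => Set.indicator_nonneg
    (fun y hy => ?_) x) (hint.const_mul _) (Eventually.of_forall fun x => ?_)
  · have hy' : k ≤ y := hy
    exact sub_nonneg.2 (Real.exp_le_one_iff.2 (by linarith))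
  by_cases hx : x ∈ Set.Ici k
  · have hx1 : k ≤ x := hx
    simp only [Set.indicator_of_mem hx, id, ← Real.exp_add]
    have h1 : 1 ≤ Real.exp (-t * k + t * x) := by
      rw [Real.one_le_exp_iff]
      nlinarith
    linarith [Real.exp_pos (k - x)]
  · simp only [Set.indicator_of_notMem hx]
    positivity

/-- Put-call parity in a risk-neutral model. -/
lemma callPrice_neg [IsProbabilityMeasure μ] (hone : ∫ x, Real.exp x ∂μ = 1)
    (k : ℝ) : callPrice μ (-k)
      = 1 - Real.exp (-k) + Real.exp (-k) * putPrice (μ.map (fun x => -x)) k := by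
  have hint : Integrable Real.exp μ := Integrable.of_integral_ne_zero (by rw [hone]; norm_num)
  have hput : putPrice (μ.map (fun x => -x)) k
      = ∫ x in Set.Iic (-k), (1 - Real.exp (k + x)) ∂μ := by
    rw [putPrice, setIntegral_map measurableSet_Ici
      (by fun_prop : Continuous fun y : ℝ => 1 - Real.exp (k - y)).aestronglyMeasurable
      measurable_neg.aemeasurable]
    have : (fun x : ℝ => -x) ⁻¹' Set.Ici k = Set.Iic (-k) := by
      ext x
      simp only [Set.mem_preimage, Set.mem_Ici, Set.mem_Iic]
      exact le_neg
    simp only [this, sub_neg_eq_add]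
  have hsplit := integral_add_compl (measurableSet_Ioi (a := -k))
    (hint.sub (integrable_const (Real.exp (-k))))
  rw [Set.compl_Ioi] at hsplit
  have htotal : ∫ x, (Real.exp x - Real.exp (-k)) ∂μ = 1 - Real.exp (-k) := by
    rw [integral_sub hint (integrable_const _), hone]
    simp
  have hscale : Real.exp (-k) * (∫ x in Set.Iic (-k), (1 - Real.exp (k + x)) ∂μ)
      = -∫ x in Set.Iic (-k), (Real.exp x - Real.exp (-k)) ∂μ := by
    rw [← integral_const_mul, ← integral_neg]
    congr 1
    ext x
    rw [mul_sub, ← Real.exp_add, mul_one, neg_add_cancel_left]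
    ring
  simp only [Pi.sub_apply] at hsplit
  rw [hput, hscale, callPrice, ← htotal, ← hsplit, add_neg_cancel_right]

lemma isLUB_integrableExpSet_map_neg {q : ℝ}
    (h : IsGLB (integrableExpSet id μ) (-q)) :
    IsLUB (integrableExpSet id (μ.map fun x => -x)) q := by
  have hset : integrableExpSet id (μ.map fun x => -x) = -integrableExpSet id μ := by
    ext t
    simp only [integrableExpSet, Set.mem_ofPred_eq, Set.mem_neg, id]
    rw [integrable_map_measure (by fun_prop : Continuous fun x : ℝ =>
      Real.exp (t * x)).aestronglyMeasurable measurable_neg.aemeasurable]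
    simp [Function.comp_def]
  rw [hset]
  simpa using h.neg

lemma mgf_map_neg (μ : Measure ℝ) :
    mgf id (μ.map fun x => -x) = fun t => mgf id μ (-t) := by
  ext t
  rw [mgf_id_map measurable_neg.aemeasurable]
  simp [mgf]

lemma CriterionILeft.map_neg {q : ℝ} (h : CriterionILeft μ q) :
    CriterionIRight (μ.map fun x => -x) q := by
  obtain ⟨n, h⟩ := h
  refine ⟨n, ?_⟩
  rw [mgf_map_neg]
  simpa only [iteratedDeriv_comp_neg, neg_sub, smul_eq_mul, ← sub_eq_neg_add] using h

lemma CriterionIILeft.map_neg {q : ℝ} (h : CriterionIILeft μ q) :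
    CriterionIIRight (μ.map fun x => -x) q := by
  unfold CriterionIIRight
  rw [mgf_map_neg]
  simpa only [CriterionIILeft, neg_sub, ← sub_eq_neg_add] using h

/-- Existence, uniqueness and asymptotics of the implied volatility at log-strikes `κ k`, when
implied volatilities there are the Black-Scholes inverses, at log-strike `k`, of a price `c k` of
exponential rate `p`. -/
lemma impliedVol_asymptotics {c κ : ℝ → ℝ} {p : ℝ} (hp : 0 < p)
    (hlow : ∀ ε > 0, ∀ᶠ k in atTop, Real.exp (-(p + ε) * k) ≤ c k)
    (hup : ∀ ε > 0, ∀ᶠ k in atTop, c k ≤ Real.exp (-(p - ε) * k))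
    (hiff : ∀ k v, IsImpliedVol μ (κ k) v ↔ 0 < v ∧ bsCall k v = c k) :
    (∀ᶠ k in atTop, ∃! v, IsImpliedVol μ (κ k) v) ∧
      Tendsto (fun k => impliedVol μ (κ k) ^ 2 / k) atTop (𝓝 (psi p)) := by
  have hex : ∀ᶠ k in atTop, ∃! v, IsImpliedVol μ (κ k) v := by
    filter_upwards [hlow 1 one_pos, hup (p / 2) (half_pos hp), eventually_gt_atTop 0]
      with k h1 h2 hk
    simp only [hiff]
    refine existsUnique_bsCall_eq hk ⟨(Real.exp_pos _).trans_le h1, h2.trans_lt ?_⟩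
    rw [Real.exp_lt_one_iff]
    nlinarith
  refine ⟨hex, tendsto_sq_div_of_bsCall_eq hp hlow hup ?_⟩
  filter_upwards [hex] with k hk
  exact (hiff k _).1 (Classical.epsilon_spec hk.exists)

end Prices

end Smile

theorem mainTheorem3 (μ : Measure ℝ) [IsProbabilityMeasure μ] :
    (∀ q : ℝ, 0 < q → (∫ x, Real.exp x ∂μ) = 1 →
      IsGLB (integrableExpSet id μ) (-q) →
      (Smile.CriterionILeft μ q ∨ Smile.CriterionIILeft μ q) →
      (∀ᶠ k in atTop, ∃! v, Smile.IsImpliedVol μ (-k) v) ∧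
        Tendsto (fun k : ℝ => Smile.impliedVol μ (-k) ^ 2 / k) atTop (𝓝 (Smile.psi q))) ∧
    (∀ p : ℝ, 0 < p →
      IsLUB (integrableExpSet id μ) (p + 1) →
      (Smile.CriterionIRight μ (p + 1) ∨ Smile.CriterionIIRight μ (p + 1)) →
      (∀ᶠ k in atTop, ∃! v, Smile.IsImpliedVol μ k v) ∧
        Tendsto (fun k : ℝ => Smile.impliedVol μ k ^ 2 / k) atTop (𝓝 (Smile.psi p))) := by
  refine ⟨fun q hq hone hglb hcrit => ?_, fun p hp hlub hcrit => ?_⟩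
  · have hprob : IsProbabilityMeasure (μ.map fun x : ℝ => -x) :=
      Measure.isProbabilityMeasure_map measurable_neg.aemeasurable
    have hlub := Smile.isLUB_integrableExpSet_map_neg hglb
    have hmem := Smile.Ioo_subset_interior_integrableExpSet hlub
    have htail : ∀ ε > 0, ∀ᶠ x in atTop,
        Real.exp (-(q + ε) * x) ≤ (μ.map fun x : ℝ => -x).real (Set.Ioi x) := fun ε hε =>
      Smile.eventually_exp_le_of_criterion hq hlub
        (hcrit.imp Smile.CriterionILeft.map_neg Smile.CriterionIILeft.map_neg) hε
    refine Smile.impliedVol_asymptotics (c := Smile.putPrice (μ.map fun x : ℝ => -x))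
      (κ := fun k => -k) hq (fun ε hε => ?_) (fun ε hε => ?_) fun k v => ?_
    · filter_upwards [Smile.eventually_exp_le_const_mul_measure_Ioi_add_one htail
        (show 0 < 1 - Real.exp (-1) from sub_pos.2 (Real.exp_lt_one_iff.2 (by norm_num))) hε] with k hk
      exact hk.trans (Smile.le_putPrice k)
    · obtain ⟨t, ht1, ht2⟩ := exists_between (max_lt hq (sub_lt_self q hε))
      filter_upwards [Smile.eventually_const_mul_exp_le
        (mgf id (μ.map fun x : ℝ => -x) t) ((le_max_right _ _).trans_lt ht1)] with k hk
      have ht0 : 0 < t := (le_max_left _ _).trans_lt ht1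
      exact (Smile.putPrice_le ht0.le (interior_subset (hmem ⟨ht0, ht2⟩)) k).trans hk
    · rw [Smile.IsImpliedVol, Smile.bsCall_neg, Smile.callPrice_neg hone, add_right_inj,
        mul_right_inj' (Real.exp_pos _).ne']
  · have hp1 : 0 < p + 1 := by linarith
    have hmem := Smile.Ioo_subset_interior_integrableExpSet hlub
    have hint : Integrable Real.exp μ := by
      have h : (1 : ℝ) ∈ integrableExpSet id μ :=
        interior_subset (hmem ⟨one_pos, by linarith⟩)
      simpa [integrableExpSet] using h
    have htail : ∀ ε > 0, ∀ᶠ x in atTop,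
        Real.exp (-((p + 1) + ε) * x) ≤ μ.real (Set.Ioi x) := fun ε hε =>
      Smile.eventually_exp_le_of_criterion hp1 hlub hcrit hε
    refine Smile.impliedVol_asymptotics (c := Smile.callPrice μ) (κ := fun k => k) hp
      (fun ε hε => ?_) (fun ε hε => ?_) fun k v => Iff.rfl
    · filter_upwards [Smile.eventually_exp_le_const_mul_measure_Ioi_add_one htail
        (show 0 < Real.exp 1 - 1 from sub_pos.2 (Real.one_lt_exp_iff.2 one_pos)) hε] with k hk
      refine le_trans ?_ (Smile.le_callPrice hint k)
      refine le_trans (le_of_eq ?_) (mul_le_mul_of_nonneg_left hk (Real.exp_pos k).le)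
      rw [← Real.exp_add]
      congr 1
      ring
    · obtain ⟨t, ht1, ht2⟩ := exists_between
        (max_lt (show (1 : ℝ) < p + 1 by linarith) (sub_lt_self (p + 1) hε))
      have ht0 : 1 < t := (le_max_left _ _).trans_lt ht1
      have ht3 : p + 1 - ε < t := (le_max_right _ _).trans_lt ht1
      filter_upwards [Smile.eventually_const_mul_exp_le (mgf id μ t)
        (show p - ε < t - 1 by linarith)] with k hk
      exact (Smile.callPrice_le ht0.le
        (interior_subset (hmem ⟨by linarith, ht2⟩)) k).trans hk
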